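/- **Setting (uncapacitated online dial-a-ride, OLDARP).** Let $(M,d)$ be a geodesic metric space (any two points are joined by a path whose length is their distance) with an origin $o\in M$. An input $\mathbf x$ is a sequence of $n\ge 1$ requests $x_i=(t_i,a_i,b_i)$ with arrival times $0\le t_1\le\dots\le t_n$, pickup positions $a_i$ and delivery positions $b_i$. A server of unlimited capacity starts at $o$ at time $0$ and moves with speed at most one; it has to pick up each request $x_i$ at $a_i$ no earlier than $t_i$, deliver it at $b_i$ (a request that has been picked up may be dropped only at its delivery position), and finally return to $o$. The completion time is to be minimized; $Z^{OPT}$ is the offline optimal completion time. **Algorithm LADAR-Last.** The algorithm is given a prediction $\hat t_n\in\mathbb R$ of $t_n$; request $x_i$ becomes known at time $t_i$. Let $U_t$ be the set of requests released by time $t$ and not delivered before $t$ (some of them may be on board). When the server is at $o$ at time $t$ (at the start, after a trip, or upon an arrival while it waits) and $U_t\neq\emptyset$, it computes a shortest route $T_{U_t}$ that starts at $o$, serves all of $U_t$ (requests on board only have to be delivered) and returns to $o$. If $t<\hat t_n<t+|T_{U_t}|$, it follows $T_{U_t}$ until a moment $t_{back}$ with $t_{back}+d(p(t_{back}),o)=\hat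 t_n$, where $p(s)$ is its position at time $s$, and then moves to $o$ along a shortest path, reaching it at time $\hat t_n$; otherwise it follows $T_{U_t}$ to its end. If a new request arrives during a trip, the server immediately goes back to $o$ along a shortest path, carrying all requests on board, and plans again there. If $U_t=\emptyset$, it waits at $o$ for the next request. Ties (among optimal routes, shortest paths, or moments $t_{back}$) may be broken arbitrarily. $Z^{ALG}$ is the time at which all requests have been served and the server is back at $o$. **Theorem.** Let $\varepsilon_{last}=\hat t_n-t_n$. On every input and for every prediction, LADAR-Last has an execution, each of its executions serves all requests and ends, and each of them satisfies $$Z^{ALG}\ \le\ \min\Bigl\{3.5,\ 2+\frac{|\varepsilon_{last}|}{Z^{OPT}}\Bigr\}\cdot Z^{OPT}$$ (if $Z^{OPT}=0$ this reads $Z^{ALG}\le 0$). Hence LADAR-Last is * $2$-consistent: its competitive ratio over all inputs (in all geodesic metric spaces) with $\varepsilon_{last}=0$ is exactly $2$, i.e. $2$ is the least $c$ such that $Z^{ALG}\le c\,Z^{OPT}$ for all of them; * $3.5$-robust: $Z^{ALG}\le 3.5\,Z^{OPT}$ for every value of $\varepsilon_{last}$; * $|\varepsilon_{last}|$-smooth: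 $Z^{ALG}\le 2\,Z^{OPT}+f(\varepsilon_{last})$ always, where $f(\varepsilon)=|\varepsilon|$ is continuous with $f(0)=0$. -/

import Mathlib

universe u

namespace DialARide

/-- `γ` runs, at unit speed, along a shortest path from `x` to `y` (on `[0, dist x y]`). -/
def IsShortestPath {M : Type u} [MetricSpace M] (x y : M) (γ : ℝ → M) : Prop :=
  γ 0 = x ∧ γ (dist x y) = y ∧
    ∀ s ∈ Set.Icc 0 (dist x y), ∀ t ∈ Set.Icc 0 (dist x y), dist (γ s) (γ t) = |s - t|

/-- Any two points are joined by a path whose length is their distance. -/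
def IsGeodesic (M : Type u) [MetricSpace M] : Prop :=
  ∀ x y : M, ∃ γ : ℝ → M, IsShortestPath x y γ

/-- An input of the online dial-a-ride problem: an origin and a nonempty sequence of requests,
in non-decreasing order of arrival time. -/
structure Instance (M : Type u) where
  /-- the number of requests -/
  n : ℕ
  n_pos : 0 < n
  /-- the origin of the server -/
  o : M
  /-- the arrival times -/
  t : Fin n → ℝ
  t_nonneg : ∀ i, 0 ≤ t i
  t_mono : Monotone t
  /-- the pickup positions -/
  a : Fin n → M
  /-- the delivery positions -/
  b : Fin n → M

/-- The arrival time of the last request. -/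
def Instance.tLast {M : Type u} (x : Instance M) : ℝ :=
  x.t ⟨x.n - 1, Nat.sub_lt x.n_pos Nat.one_pos⟩

/-! ### The offline optimum -/

/-- `Z` is the completion time of some feasible (offline) schedule: a trajectory `p` of speed at
most one, starting at the origin at time `0` and being there at time `Z`, with pickup times `u i`
and delivery times `v i`. The capacity is unlimited, and request `i` is on board throughout
`[u i, v i]` (non-preemptive). -/
def Instance.IsFeasible {M : Type u} [MetricSpace M] (x : Instance M) (Z : ℝ) : Prop :=
  ∃ (p : ℝ → M) (u v : Fin x.n → ℝ),
    p 0 = x.o ∧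
    (∀ s t : ℝ, 0 ≤ s → 0 ≤ t → dist (p s) (p t) ≤ |s - t|) ∧
    (∀ i, x.t i ≤ u i ∧ p (u i) = x.a i ∧ u i ≤ v i ∧ p (v i) = x.b i ∧ v i ≤ Z) ∧
    p Z = x.o

/-- The offline optimal cost. -/
noncomputable def Instance.Zopt {M : Type u} [MetricSpace M] (x : Instance M) : ℝ :=
  sInf {Z : ℝ | x.IsFeasible Z}

/-! ### Routes -/

/-- A stop of a route: the pickup or the delivery of a request. -/
inductive Stop (n : ℕ) where
  | pickup (i : Fin n) : Stop n
  | deliver (i : Fin n) : Stop n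

/-- The position of a stop. -/
def Instance.pos {M : Type u} (x : Instance M) : Stop x.n → M
  | Stop.pickup i => x.a i
  | Stop.deliver i => x.b i

/-- The length of the polygonal path from the point `p` through the points of a list. -/
noncomputable def pathLength {M : Type u} [MetricSpace M] : M → List M → ℝ
  | _, [] => 0
  | p, q :: l => dist p q + pathLength q l

/-- The position after moving for time `s` at unit speed from `p` through the points of a list,
along the shortest paths `γ`. -/
noncomputable def posAlong {M : Type u} [MetricSpace M] (γ : M → M → ℝ → M) :
    M → List M → ℝ → M
  | p, [], _ => p
  | p, q :: l, s =>
    open Classical in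
    if s ≤ dist p q then γ p q s else posAlong γ q l (s - dist p q)

/-- The stops of a list that have been reached after moving for time `s` at unit speed from `p`. -/
noncomputable def Instance.reached {M : Type u} [MetricSpace M] (x : Instance M) :
    M → List (Stop x.n) → ℝ → List (Stop x.n)
  | _, [], _ => []
  | p, e :: l, s =>
    open Classical in
    if dist p (x.pos e) ≤ s then e :: x.reached (x.pos e) l (s - dist p (x.pos e)) else []

/-- The points that a route visits after leaving the origin; the last one is the origin. -/
def Instance.points {M : Type u} (x : Instance M) (R : List (Stop x.n)) : List M :=
  R.map x.pos ++ [x.o]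

/-- The length `|T|` of a route that starts and ends at the origin. -/
noncomputable def Instance.routeLength {M : Type u} [MetricSpace M] (x : Instance M)
    (R : List (Stop x.n)) : ℝ :=
  pathLength x.o (x.points R)

/-! ### The algorithm -/

/-- A moment at which the server is at the origin and decides what to do next: the current time,
the requests picked up so far, and the requests delivered so far. Requests that are picked up and
not delivered are on board. -/
@[ext] structure State (n : ℕ) where
  time : ℝ
  picked : Set (Fin n)
  delivered : Set (Fin n)

/-- The initial state. -/
def State.init (n : ℕ) : State n := ⟨0, ∅, ∅⟩

/-- All requests have been served (and the server is at the origin). -/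
def State.Finished {n : ℕ} (s : State n) : Prop := ∀ i, i ∈ s.delivered

/-- The set `U_t` of the released unserved requests. -/
def Instance.unserved {M : Type u} (x : Instance M) (s : State x.n) : Set (Fin x.n) :=
  {i | x.t i ≤ s.time ∧ i ∉ s.delivered}

/-- The route `R` serves exactly the released unserved requests: those not yet on board are picked
up and then delivered, those on board are delivered. -/
def Instance.IsRoute {M : Type u} (x : Instance M) (s : State x.n) (R : List (Stop x.n)) : Prop :=
  R.Nodup ∧
  (∀ i, Stop.pickup i ∈ R ↔ i ∈ x.unserved s ∧ i ∉ s.picked) ∧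
  (∀ i, Stop.deliver i ∈ R ↔ i ∈ x.unserved s) ∧
  (∀ i, Stop.pickup i ∈ R → [Stop.pickup i, Stop.deliver i].Sublist R)

/-- The route `R` is a shortest one that serves the released unserved requests. -/
def Instance.IsOptimalRoute {M : Type u} [MetricSpace M] (x : Instance M) (s : State x.n)
    (R : List (Stop x.n)) : Prop :=
  x.IsRoute s R ∧ ∀ R', x.IsRoute s R' → x.routeLength R ≤ x.routeLength R'

/-- The route `R`, started at time `t`, is left after the elapsed time `c` in order to move straight
to the origin: if the predicted last arrival time `that` lies in the future and before the end of
the route, then `t + c` is a moment `t_back` such that the server is at the origin exactly at time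
`that`; otherwise the whole route is followed. -/
def Instance.IsCut {M : Type u} [MetricSpace M] (x : Instance M) (that : ℝ) (γ : M → M → ℝ → M)
    (t : ℝ) (R : List (Stop x.n)) (c : ℝ) : Prop :=
  (t < that ∧ that < t + x.routeLength R ∧ 0 ≤ c ∧ c ≤ x.routeLength R ∧
    t + c + dist (posAlong γ x.o (x.points R) c) x.o = that) ∨
  (¬ (t < that ∧ that < t + x.routeLength R) ∧ c = x.routeLength R)

/-- The position at elapsed time `s` of a server that follows `R` up to the elapsed time `c` and
then moves to the origin along a shortest path. -/
noncomputable def Instance.tripPos {M : Type u} [MetricSpace M] (x : Instance M)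
    (γ : M → M → ℝ → M) (R : List (Stop x.n)) (c s : ℝ) : M :=
  open Classical in
  if s ≤ c then posAlong γ x.o (x.points R) s
  else γ (posAlong γ x.o (x.points R) c) x.o (s - c)

/-- The total duration of this trip. -/
noncomputable def Instance.tripTime {M : Type u} [MetricSpace M] (x : Instance M)
    (γ : M → M → ℝ → M) (R : List (Stop x.n)) (c : ℝ) : ℝ :=
  c + dist (posAlong γ x.o (x.points R) c) x.o

/-- The state at time `t`, after the stops in `D` have been performed. -/
def State.update {n : ℕ} (s : State n) (t : ℝ) (D : List (Stop n)) : State n :=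
  ⟨t, s.picked ∪ {i | Stop.pickup i ∈ D}, s.delivered ∪ {i | Stop.deliver i ∈ D}⟩

/-- `τ` is the first arrival time after `t`. -/
def Instance.IsNextArrival {M : Type u} (x : Instance M) (t τ : ℝ) : Prop :=
  IsLeast {r | t < r ∧ ∃ i, x.t i = r} τ

/-- One step of LADAR-Last with predicted last arrival time `that`, from one moment of decision at
the origin to the next. Ties (among optimal routes, shortest paths, or moments `t_back`) may be
broken in any way. -/
inductive Step {M : Type u} [MetricSpace M] (x : Instance M) (that : ℝ) :
    State x.n → State x.n → Prop
  /-- Everything is served: the execution is over. -/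
  | halt (s : State x.n) (h : s.Finished) : Step x that s s
  /-- Nothing to serve: wait at the origin for the next request. -/
  | wait (s : State x.n) (τ : ℝ) (hU : x.unserved s = ∅) (hτ : x.IsNextArrival s.time τ) :
      Step x that s ⟨τ, s.picked, s.delivered⟩
  /-- The planned trip is carried out, since no request arrives before its end. -/
  | complete (s : State x.n) (γ : M → M → ℝ → M) (R : List (Stop x.n)) (c : ℝ)
      (hγ : ∀ p q, IsShortestPath p q (γ p q)) (hU : (x.unserved s).Nonempty)
      (hR : x.IsOptimalRoute s R) (hc : x.IsCut that γ s.time R c)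
      (harr : ∀ i, ¬ (s.time < x.t i ∧ x.t i < s.time + x.tripTime γ R c)) :
      Step x that s (s.update (s.time + x.tripTime γ R c) (x.reached x.o R c))
  /-- A request arrives at time `τ` during the planned trip: the server goes back to the origin,
  with all the requests on board. -/
  | interrupt (s : State x.n) (γ : M → M → ℝ → M) (R : List (Stop x.n)) (c τ : ℝ)
      (hγ : ∀ p q, IsShortestPath p q (γ p q)) (hU : (x.unserved s).Nonempty)
      (hR : x.IsOptimalRoute s R) (hc : x.IsCut that γ s.time R c)
      (hτ : x.IsNextArrival s.time τ) (hlt : τ < s.time + x.tripTime γ R c) :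
      Step x that s
        (s.update (τ + dist (x.tripPos γ R c (τ - s.time)) x.o)
          (x.reached x.o R (min (τ - s.time) c)))

/-- An execution of LADAR-Last on the input `x` with predicted last arrival time `that`. -/
def IsExecution {M : Type u} [MetricSpace M] (x : Instance M) (that : ℝ)
    (σ : ℕ → State x.n) : Prop :=
  σ 0 = State.init x.n ∧ ∀ k, Step x that (σ k) (σ (k + 1))

/-- `Z` is the completion time of the execution `σ`: the first moment of decision at which all
requests have been served. -/
def CompletesAt {n : ℕ} (σ : ℕ → State n) (Z : ℝ) : Prop :=
  ∃ k, (σ k).Finished ∧ (∀ j < k, ¬ (σ j).Finished) ∧ (σ k).time = Z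

/-! ### Algorithms with a prediction of the last arrival time -/

/-- An algorithm, through its costs: `A M x that Z` says that on the input `x`, with predicted last
arrival time `that`, the algorithm may complete at time `Z`. -/
abbrev Algorithm : Type (u + 1) :=
  ∀ (M : Type u) [MetricSpace M], Instance M → ℝ → ℝ → Prop

/-- The algorithm LADAR-Last. -/
def ladarLast : Algorithm.{u} := fun _ _ x that Z =>
  ∃ σ, IsExecution x that σ ∧ CompletesAt σ Z

/-- The factors `c` such that the algorithm is `c`-competitive on the inputs whose prediction error
`that - tLast` is `ε`. -/
def competitiveFactors (A : Algorithm.{u}) (ε : ℝ) : Set ℝ :=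
  {c | ∀ (M : Type u) [MetricSpace M], IsGeodesic M → ∀ (x : Instance M) (that Z : ℝ),
    that - x.tLast = ε → A M x that Z → Z ≤ c * x.Zopt}

/-- The competitive ratio under a perfect prediction is exactly `α`. -/
def IsConsistent (A : Algorithm.{u}) (α : ℝ) : Prop :=
  IsLeast (competitiveFactors A 0) α

/-- The competitive ratio is at most `β`, whatever the prediction error is. -/
def IsRobust (A : Algorithm.{u}) (β : ℝ) : Prop :=
  ∀ ε : ℝ, β ∈ competitiveFactors A ε

/-- The cost of the `α`-consistent algorithm exceeds `α` times the optimum by at most `f ε`. -/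
def IsSmooth (A : Algorithm.{u}) (α : ℝ) (f : ℝ → ℝ) : Prop :=
  IsConsistent A α ∧ Continuous f ∧ f 0 = 0 ∧
    ∀ (M : Type u) [MetricSpace M], IsGeodesic M → ∀ (x : Instance M) (that Z : ℝ),
      A M x that Z → Z ≤ α * x.Zopt + f (that - x.tLast)

end DialARide

namespace DialARide

section Paths

variable {M : Type u} [MetricSpace M]

theorem pathLength_nonneg (p : M) (l : List M) : 0 ≤ pathLength p l := by
  induction l generalizing p with
  | nil => exact le_rfl
  | cons q l ih => exact add_nonneg dist_nonneg (ih q)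

variable {γ : M → M → ℝ → M}

theorem posAlong_zero (hγ : ∀ p q, IsShortestPath p q (γ p q)) (p : M) (l : List M) :
    posAlong γ p l 0 = p := by
  cases l with
  | nil => rfl
  | cons q l => simp [posAlong, dist_nonneg, (hγ p q).1]

theorem posAlong_cons_of_dist_le (hγ : ∀ p q, IsShortestPath p q (γ p q)) {p q : M} (l : List M)
    {s : ℝ} (hs : dist p q ≤ s) :
    posAlong γ p (q :: l) s = posAlong γ q l (s - dist p q) := by
  rw [posAlong]
  split_ifs with h
  · obtain rfl : s = dist p q := le_antisymm h hs
    rw [sub_self, posAlong_zero hγ, (hγ p q).2.1]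
  · rfl

theorem dist_posAlong_le_of_le (hγ : ∀ p q, IsShortestPath p q (γ p q)) (p : M) (l : List M)
    {s t : ℝ} (hs : 0 ≤ s) (hst : s ≤ t) :
    dist (posAlong γ p l s) (posAlong γ p l t) ≤ t - s := by
  induction l generalizing p s t with
  | nil => simpa [posAlong] using hst
  | cons q l ih =>
    have key : ∀ r, 0 ≤ r → r ≤ dist p q →
        dist (posAlong γ p (q :: l) r) q = dist p q - r := by
      intro r hr hrd
      have h := (hγ p q).2.2 r ⟨hr, hrd⟩ (dist p q) ⟨dist_nonneg, le_rfl⟩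
      rw [(hγ p q).2.1, abs_sub_comm, abs_of_nonneg (by linarith)] at h
      rw [posAlong, if_pos hrd, h]
    rcases le_total (dist p q) s with h1 | h1
    · rw [posAlong_cons_of_dist_le hγ l h1, posAlong_cons_of_dist_le hγ l (h1.trans hst)]
      have := ih q (sub_nonneg.2 h1) (sub_le_sub_right hst (dist p q))
      linarith
    · rcases le_total (dist p q) t with h2 | h2
      · have h3 := ih q le_rfl (sub_nonneg.2 h2)
        rw [posAlong_zero hγ, ← posAlong_cons_of_dist_le hγ l h2] at h3
        have := dist_triangle (posAlong γ p (q :: l) s) q (posAlong γ p (q :: l) t)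
        rw [key s hs h1] at this
        linarith
      · rw [posAlong, if_pos h1, posAlong, if_pos h2,
          (hγ p q).2.2 s ⟨hs, h1⟩ t ⟨hs.trans hst, h2⟩, abs_sub_comm,
          abs_of_nonneg (sub_nonneg.2 hst)]

theorem dist_posAlong_le (hγ : ∀ p q, IsShortestPath p q (γ p q)) (p : M) (l : List M)
    {s t : ℝ} (hs : 0 ≤ s) (ht : 0 ≤ t) :
    dist (posAlong γ p l s) (posAlong γ p l t) ≤ |s - t| := by
  rcases le_total s t with h | h
  · rw [abs_sub_comm, abs_of_nonneg (sub_nonneg.2 h)]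
    exact dist_posAlong_le_of_le hγ p l hs h
  · rw [dist_comm, abs_of_nonneg (sub_nonneg.2 h)]
    exact dist_posAlong_le_of_le hγ p l ht h

theorem posAlong_pathLength (hγ : ∀ p q, IsShortestPath p q (γ p q)) (p o : M) (l : List M) :
    posAlong γ p (l ++ [o]) (pathLength p (l ++ [o])) = o := by
  induction l generalizing p with
  | nil => simp [posAlong, pathLength, (hγ p o).2.1]
  | cons q l ih =>
    rw [List.cons_append, pathLength,
      posAlong_cons_of_dist_le hγ _ (le_add_of_nonneg_right (pathLength_nonneg _ _)),
      add_sub_cancel_left, ih]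

/-- The triangle inequality for a polygonal path that ends with `o`. -/
theorem dist_add_dist_le_pathLength {p o q : M} {l : List M} (hq : q ∈ l) :
    dist p q + dist q o ≤ pathLength p (l ++ [o]) := by
  have hend : ∀ (p : M) (l : List M), dist p o ≤ pathLength p (l ++ [o]) := by
    intro p l
    induction l generalizing p with
    | nil => simp [pathLength]
    | cons r l ih =>
      rw [List.cons_append, pathLength]
      linarith [dist_triangle p r o, ih r]
  induction l generalizing p with
  | nil => simp at hq
  | cons r l ih =>
    rw [List.cons_append, pathLength]
    rcases List.mem_cons.1 hq with rfl | h
    · linarith [hend q l]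
    · linarith [ih (p := r) h, dist_triangle p r q]

theorem Instance.reached_of_pathLength_le (x : Instance M) (p : M) (R : List (Stop x.n))
    (l : List M) {s : ℝ} (hs : pathLength p (R.map x.pos ++ l) ≤ s) : x.reached p R s = R := by
  induction R generalizing p s with
  | nil => rfl
  | cons e R ih =>
    rw [List.map_cons, List.cons_append, pathLength] at hs
    have := pathLength_nonneg (x.pos e) (R.map x.pos ++ l)
    rw [Instance.reached, if_pos (by linarith), ih _ (by linarith)]

theorem Instance.dist_add_dist_le_of_mem_reached (hγ : ∀ p q, IsShortestPath p q (γ p q))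
    (x : Instance M) (p : M) (R : List (Stop x.n)) (l : List M) {s : ℝ} {e : Stop x.n}
    (he : e ∈ x.reached p R s) :
    dist p (x.pos e) + dist (x.pos e) (posAlong γ p (R.map x.pos ++ l) s) ≤ s := by
  induction R generalizing p s with
  | nil => simp [Instance.reached] at he
  | cons f R ih =>
    rw [Instance.reached] at he
    split_ifs at he with h
    · rw [List.map_cons, List.cons_append, posAlong_cons_of_dist_le hγ _ h]
      rcases List.mem_cons.1 he with rfl | he
      · have := dist_posAlong_le_of_le hγ (x.pos e) (R.map x.pos ++ l) le_rfl (sub_nonneg.2 h)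
        rw [posAlong_zero hγ] at this
        linarith
      · linarith [ih _ he, dist_triangle p (x.pos f) (x.pos e)]
    · simp at he

end Paths

/-! ### Trips -/

section Trips

variable {M : Type u} [MetricSpace M] {x : Instance M} {γ : M → M → ℝ → M} {R : List (Stop x.n)}
  {that t c : ℝ}

theorem Instance.routeLength_nonneg (x : Instance M) (R : List (Stop x.n)) :
    0 ≤ x.routeLength R :=
  pathLength_nonneg _ _

theorem Instance.posAlong_routeLength (hγ : ∀ p q, IsShortestPath p q (γ p q)) (x : Instance M)
    (R : List (Stop x.n)) : posAlong γ x.o (x.points R) (x.routeLength R) = x.o :=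
  posAlong_pathLength hγ _ _ _

theorem Instance.exists_isCut (hγ : ∀ p q, IsShortestPath p q (γ p q)) (x : Instance M)
    (R : List (Stop x.n)) (that t : ℝ) : ∃ c, x.IsCut that γ t R c := by
  by_cases h : t < that ∧ that < t + x.routeLength R
  · have hL := x.routeLength_nonneg R
    have hlip : LipschitzOnWith 1 (posAlong γ x.o (x.points R)) (Set.Icc 0 (x.routeLength R)) :=
      LipschitzOnWith.of_dist_le_mul fun s hs s' hs' => by
        simpa [Real.dist_eq] using dist_posAlong_le hγ x.o (x.points R) hs.1 hs'.1
    have hcont : ContinuousOn (fun c => t + c + dist (posAlong γ x.o (x.points R) c) x.o)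
        (Set.Icc 0 (x.routeLength R)) :=
      (continuousOn_const.add continuousOn_id).add ((continuous_id.dist continuous_const).comp_continuousOn hlip.continuousOn)
    obtain ⟨c, hc, hc'⟩ := intermediate_value_Icc hL hcont (show that ∈ _ by
      simp only [posAlong_zero hγ, x.posAlong_routeLength hγ, dist_self, add_zero]
      exact ⟨h.1.le, h.2.le⟩)
    exact ⟨c, Or.inl ⟨h.1, h.2, hc.1, hc.2, hc'⟩⟩
  · exact ⟨_, Or.inr ⟨h, rfl⟩⟩

theorem Instance.IsCut.nonneg (hc : x.IsCut that γ t R c) : 0 ≤ c := by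
  rcases hc with h | h
  · exact h.2.2.1
  · exact h.2 ▸ x.routeLength_nonneg R

theorem Instance.IsCut.tripTime_nonneg (hc : x.IsCut that γ t R c) : 0 ≤ x.tripTime γ R c :=
  add_nonneg hc.nonneg dist_nonneg

/-- A trip either is a whole route or ends at the predicted time. -/
theorem Instance.IsCut.tripTime_eq (hγ : ∀ p q, IsShortestPath p q (γ p q))
    (hc : x.IsCut that γ t R c) :
    (t < that ∧ that < t + x.routeLength R ∧ t + x.tripTime γ R c = that) ∨
      (¬ (t < that ∧ that < t + x.routeLength R) ∧ c = x.routeLength R ∧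
        x.tripTime γ R c = x.routeLength R) := by
  rcases hc with ⟨h1, h2, -, -, h5⟩ | ⟨h1, rfl⟩
  · exact Or.inl ⟨h1, h2, by rw [tripTime, ← add_assoc, h5]⟩
  · exact Or.inr ⟨h1, rfl, by rw [tripTime, x.posAlong_routeLength hγ, dist_self, add_zero]⟩

theorem Instance.IsCut.tripTime_le (hγ : ∀ p q, IsShortestPath p q (γ p q))
    (hc : x.IsCut that γ t R c) : x.tripTime γ R c ≤ x.routeLength R := by
  rcases hc.tripTime_eq hγ with h | h
  · linarith
  · exact h.2.2.le

theorem Instance.IsCut.add_tripTime_le (hγ : ∀ p q, IsShortestPath p q (γ p q))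
    (hc : x.IsCut that γ t R c) (ht : t < that) : t + x.tripTime γ R c ≤ that := by
  rcases hc.tripTime_eq hγ with h | ⟨h1, -, h2⟩
  · exact h.2.2.le
  · rw [h2]
    exact not_lt.1 fun h => h1 ⟨ht, h⟩

theorem Instance.dist_tripPos_le (hγ : ∀ p q, IsShortestPath p q (γ p q)) (x : Instance M)
    (R : List (Stop x.n)) (hc : 0 ≤ c) {s : ℝ} (hs : 0 ≤ s) (hs' : s ≤ x.tripTime γ R c) :
    dist (x.tripPos γ R c s) x.o ≤ s ∧ dist (x.tripPos γ R c s) x.o ≤ x.tripTime γ R c - s := by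
  have hzero : ∀ r, 0 ≤ r → dist (posAlong γ x.o (x.points R) r) x.o ≤ r := by
    intro r hr
    have := dist_posAlong_le_of_le hγ x.o (x.points R) le_rfl hr
    rwa [posAlong_zero hγ, sub_zero, dist_comm] at this
  rw [tripTime] at hs' ⊢
  rw [tripPos]
  split_ifs with h
  · refine ⟨hzero s hs, ?_⟩
    have h1 := dist_posAlong_le_of_le hγ x.o (x.points R) hs h
    linarith [dist_triangle (posAlong γ x.o (x.points R) s) (posAlong γ x.o (x.points R) c) x.o]
  · have h0 := hzero c hc
    set q := posAlong γ x.o (x.points R) c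
    have h1 := (hγ q x.o).2.2 (s - c) ⟨by linarith, by linarith⟩ (dist q x.o)
      ⟨dist_nonneg, le_rfl⟩
    rw [(hγ q x.o).2.1, abs_sub_comm, abs_of_nonneg (by linarith)] at h1
    rw [h1]
    constructor <;> linarith

end Trips

/-! ### Existence of optimal routes -/

theorem Stop.finite (n : ℕ) : Finite (Stop n) :=
  Finite.of_injective (β := Fin n ⊕ Fin n)
    (fun | .pickup i => .inl i | .deliver i => .inr i) (by
      rintro (i | i) (j | j) h <;> simp_all)

theorem Instance.exists_isRoute {M : Type u} (x : Instance M) (s : State x.n) :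
    ∃ R, x.IsRoute s R := by
  classical
  let P := (Finset.univ.filter fun i => i ∈ x.unserved s ∧ i ∉ s.picked).toList
  let D := (Finset.univ.filter fun i => i ∈ x.unserved s).toList
  have hP : ∀ i, Stop.pickup i ∈ P.map Stop.pickup ++ D.map Stop.deliver ↔
      i ∈ x.unserved s ∧ i ∉ s.picked := by simp [P]
  have hD : ∀ i, Stop.deliver i ∈ P.map Stop.pickup ++ D.map Stop.deliver ↔
      i ∈ x.unserved s := by simp [D]
  refine ⟨P.map Stop.pickup ++ D.map Stop.deliver, ?_, hP, hD, fun i hi => ?_⟩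
  · refine List.nodup_append.2 ⟨(Finset.nodup_toList _).map fun _ _ h => Stop.pickup.inj h,
      (Finset.nodup_toList _).map fun _ _ h => Stop.deliver.inj h, ?_⟩
    simp
  · have h := (hP i).1 hi
    refine List.Sublist.append (l₁ := [Stop.pickup i]) (r₁ := [Stop.deliver i]) ?_ ?_
    · simpa [P] using h
    · simpa [D] using h.1

theorem Instance.exists_isOptimalRoute {M : Type u} [MetricSpace M] (x : Instance M)
    (s : State x.n) : ∃ R, x.IsOptimalRoute s R := by
  have := Stop.finite x.n
  have := Fintype.ofFinite (Stop x.n)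
  have hfin : {R | x.IsRoute s R}.Finite :=
    (List.finite_length_le (Stop x.n) (Fintype.card (Stop x.n))).subset
      fun R hR => hR.1.length_le_card
  obtain ⟨R, hR, hmin⟩ := Set.exists_min_image _ x.routeLength hfin (x.exists_isRoute s)
  exact ⟨R, hR, hmin⟩

/-! ### Comparison with offline schedules -/

theorem pair_sublist_of_pairwise {α β : Type*} [LinearOrder β] (key : α → β) {l : List α}
    (hl : l.Pairwise fun e f => key e ≤ key f) {e f : α} (he : e ∈ l) (hf : f ∈ l)
    (hef : key e < key f) : [e, f].Sublist l := by
  induction l with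
  | nil => simp at he
  | cons g l ih =>
    rw [List.pairwise_cons] at hl
    rcases List.mem_cons.1 he with rfl | he'
    · rcases List.mem_cons.1 hf with rfl | hf'
      · exact absurd hef (lt_irrefl _)
      · simpa using hf'
    · rcases List.mem_cons.1 hf with rfl | hf'
      · exact absurd hef (not_lt.2 (hl.1 e he'))
      · exact (ih hl.2 he' hf').cons g

/-- A trajectory of speed at most one that visits points in the order of a list takes at least as
long as the polygonal path through these points. -/
theorem pathLength_le_of_trajectory {M : Type u} [MetricSpace M] {α : Type*} {p : ℝ → M}
    (hp : ∀ s t : ℝ, 0 ≤ s → 0 ≤ t → dist (p s) (p t) ≤ |s - t|) (τ : α → ℝ) {Z : ℝ}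
    (l : List α) (hl : l.Pairwise fun e f => τ e ≤ τ f) {s : ℝ} (hs : 0 ≤ s) (hsZ : s ≤ Z)
    (hτ : ∀ e ∈ l, s ≤ τ e ∧ τ e ≤ Z) :
    pathLength (p s) (l.map (fun e => p (τ e)) ++ [p Z]) ≤ Z - s := by
  have hp' : ∀ s t : ℝ, 0 ≤ s → s ≤ t → dist (p s) (p t) ≤ t - s := fun s t h0 h => by
    simpa [abs_sub_comm s t, abs_of_nonneg (sub_nonneg.2 h)] using hp s t h0 (h0.trans h)
  induction l generalizing s with
  | nil => simpa [pathLength] using hp' s Z hs hsZ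
  | cons e l ih =>
    rw [List.pairwise_cons] at hl
    obtain ⟨h1, h2⟩ := hτ e List.mem_cons_self
    have h3 := ih hl.2 (hs.trans h1) h2 fun f hf =>
      ⟨hl.1 f hf, (hτ f (List.mem_cons_of_mem _ hf)).2⟩
    rw [List.map_cons, List.cons_append, pathLength]
    linarith [hp' s (τ e) hs h1]

theorem Instance.t_le_tLast {M : Type u} (x : Instance M) (i : Fin x.n) : x.t i ≤ x.tLast :=
  x.t_mono (Fin.le_def.2 (Nat.le_sub_one_of_lt i.2))

theorem Instance.tLast_nonneg {M : Type u} (x : Instance M) : 0 ≤ x.tLast := x.t_nonneg _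

section Feasible

variable {M : Type u} [MetricSpace M] {x : Instance M} {Z : ℝ}

theorem Instance.IsFeasible.tLast_le (h : x.IsFeasible Z) : x.tLast ≤ Z := by
  obtain ⟨p, u, v, -, -, h, -⟩ := h
  obtain ⟨h1, -, h2, -, h3⟩ := h ⟨x.n - 1, Nat.sub_lt x.n_pos Nat.one_pos⟩
  exact h1.trans (h2.trans h3)

theorem Instance.IsFeasible.exists_isRoute (h : x.IsFeasible Z) (s : State x.n) :
    ∃ R, x.IsRoute s R ∧ x.routeLength R ≤ Z := by
  classical
  have hZ := x.tLast_nonneg.trans h.tLast_le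
  obtain ⟨p, u, v, hp0, hp, huv, hpZ⟩ := h
  let τ : Stop x.n → ℝ := fun e => match e with | .pickup i => u i | .deliver i => v i
  let key : Stop x.n → ℝ ×ₗ ℕ := fun e =>
    toLex (τ e, match e with | .pickup _ => 0 | .deliver _ => 1)
  have hpos : ∀ e, p (τ e) = x.pos e := by
    rintro (i | i)
    · exact (huv i).2.1
    · exact (huv i).2.2.2.1
  have hτ : ∀ e, 0 ≤ τ e ∧ τ e ≤ Z := by
    rintro (i | i) <;> obtain ⟨h1, -, h2, -, h3⟩ := huv i
    · exact ⟨(x.t_nonneg i).trans h1, h2.trans h3⟩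
    · exact ⟨((x.t_nonneg i).trans h1).trans h2, h3⟩
  obtain ⟨R₀, h1, h2, h3, -⟩ := x.exists_isRoute s
  let r : Stop x.n → Stop x.n → Prop := fun e f => key e ≤ key f
  have : Std.Total r := ⟨fun e f => le_total (key e) (key f)⟩
  have : IsTrans _ r := ⟨fun _ _ _ h h' => le_trans (α := ℝ ×ₗ ℕ) h h'⟩
  have hsort := List.pairwise_insertionSort r R₀
  have hperm := List.perm_insertionSort r R₀
  set R := R₀.insertionSort r
  refine ⟨R, ⟨hperm.nodup_iff.2 h1, fun i => hperm.mem_iff.trans (h2 i),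
    fun i => hperm.mem_iff.trans (h3 i), fun i hi => ?_⟩, ?_⟩
  · refine pair_sublist_of_pairwise key hsort hi
      (hperm.mem_iff.2 ((h3 i).2 ((h2 i).1 (hperm.mem_iff.1 hi)).1)) ?_
    rw [Prod.Lex.toLex_lt_toLex]
    rcases (huv i).2.2.1.lt_or_eq with h | h
    · exact Or.inl h
    · exact Or.inr ⟨h, Nat.zero_lt_one⟩
  · have hle := pathLength_le_of_trajectory hp τ R
      (hsort.imp fun {e f} (h : key e ≤ key f) => by
        rcases Prod.Lex.toLex_le_toLex.1 h with h | h
        · exact h.le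
        · exact h.1.le) le_rfl hZ (fun e _ => hτ e)
    rwa [hp0, hpZ, sub_zero, List.map_congr_left fun e _ => hpos e] at hle

theorem Instance.IsFeasible.routeLength_le (h : x.IsFeasible Z) {s : State x.n}
    {R : List (Stop x.n)} (hR : x.IsOptimalRoute s R) : x.routeLength R ≤ Z := by
  obtain ⟨R', hR', hle⟩ := h.exists_isRoute s
  exact (hR.2 R' hR').trans hle

/-- A server that moves along shortest paths can serve the requests of a list one by one. -/
theorem Instance.exists_times_posAlong {γ : M → M → ℝ → M}
    (hγ : ∀ p q, IsShortestPath p q (γ p q)) (x : Instance M) (l : List (Fin x.n)) (p : M)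
    {i : Fin x.n} (hi : i ∈ l) :
    let L := l.flatMap (fun j => [x.a j, x.b j]) ++ [x.o]
    ∃ u v, 0 ≤ u ∧ u ≤ v ∧ v ≤ pathLength p L ∧ posAlong γ p L u = x.a i ∧
      posAlong γ p L v = x.b i := by
  induction l generalizing p with
  | nil => simp at hi
  | cons j l ih =>
    have ha : 0 ≤ dist p (x.a j) := dist_nonneg
    have hb : 0 ≤ dist (x.a j) (x.b j) := dist_nonneg
    simp only [List.flatMap_cons, List.cons_append, List.nil_append, pathLength]
    set L := l.flatMap (fun j => [x.a j, x.b j]) ++ [x.o] with hL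
    have hshift : ∀ r, 0 ≤ r → posAlong γ p (x.a j :: x.b j :: L)
        (dist p (x.a j) + (dist (x.a j) (x.b j) + r)) = posAlong γ (x.b j) L r := by
      intro r hr
      rw [posAlong_cons_of_dist_le hγ _ (by linarith), add_sub_cancel_left,
        posAlong_cons_of_dist_le hγ _ (by linarith), add_sub_cancel_left]
    rcases List.mem_cons.1 hi with rfl | hi
    · refine ⟨dist p (x.a i), dist p (x.a i) + (dist (x.a i) (x.b i) + 0), ha, by linarith,
        by linarith [pathLength_nonneg (x.b i) L], ?_, ?_⟩
      · rw [posAlong_cons_of_dist_le hγ _ le_rfl, sub_self, posAlong_zero hγ]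
      · rw [hshift 0 le_rfl, posAlong_zero hγ]
    · obtain ⟨u, v, h1, h2, h3, h4, h5⟩ := ih (x.b j) hi
      refine ⟨dist p (x.a j) + (dist (x.a j) (x.b j) + u),
        dist p (x.a j) + (dist (x.a j) (x.b j) + v), by linarith, by linarith, by linarith, ?_, ?_⟩
      · rw [hshift u h1, h4]
      · rw [hshift v (h1.trans h2), h5]

theorem IsGeodesic.exists_shortestPaths (hM : IsGeodesic M) :
    ∃ γ : M → M → ℝ → M, ∀ p q, IsShortestPath p q (γ p q) := by
  choose γ hγ using hM
  exact ⟨γ, hγ⟩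

theorem Instance.exists_isFeasible (hM : IsGeodesic M) (x : Instance M) :
    ∃ Z, x.IsFeasible Z := by
  obtain ⟨γ, hγ⟩ := hM.exists_shortestPaths
  let L := (List.finRange x.n).flatMap (fun j => [x.a j, x.b j]) ++ [x.o]
  have hT := x.tLast_nonneg
  choose u v h0 huv hv hu' hv' using fun i : Fin x.n =>
    x.exists_times_posAlong hγ (List.finRange x.n) x.o (List.mem_finRange i)
  have hpos : ∀ s, 0 ≤ s →
      posAlong γ x.o L (max (x.tLast + s - x.tLast) 0) = posAlong γ x.o L s := fun s hs => by
    rw [add_sub_cancel_left, max_eq_left hs]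
  refine ⟨x.tLast + pathLength x.o L, fun s => posAlong γ x.o L (max (s - x.tLast) 0),
    fun i => x.tLast + u i, fun i => x.tLast + v i, ?_, fun s t _ _ => ?_, fun i =>
      ⟨by linarith [x.t_le_tLast i, h0 i], ?_, by linarith [huv i], ?_, by linarith [hv i]⟩, ?_⟩
  · simp only [zero_sub]
    rw [max_eq_right (by linarith), posAlong_zero hγ]
  · refine (dist_posAlong_le hγ _ _ (le_max_right _ _) (le_max_right _ _)).trans ?_
    exact (abs_max_sub_max_le_abs _ _ _).trans_eq (by rw [sub_sub_sub_cancel_right])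
  · exact (hpos _ (h0 i)).trans (hu' i)
  · exact (hpos _ ((h0 i).trans (huv i))).trans (hv' i)
  · exact (hpos _ (pathLength_nonneg _ _)).trans (posAlong_pathLength hγ _ _ _)

end Feasible

/-! ### Executions -/

theorem Instance.exists_isNextArrival {M : Type u} (x : Instance M) {t : ℝ} {i : Fin x.n} (hi : t < x.t i) :
    ∃ τ, x.IsNextArrival t τ ∧ τ ≤ x.t i := by
  have hfin : {j | t < x.t j}.Finite := Set.toFinite _
  obtain ⟨j, hj, hmin⟩ := Set.exists_min_image _ x.t hfin ⟨i, hi⟩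
  refine ⟨x.t j, ⟨⟨hj, j, rfl⟩, ?_⟩, hmin i hi⟩
  rintro _ ⟨hr, k, rfl⟩
  exact hmin k hr

theorem Instance.IsNextArrival.le_tLast {M : Type u} {x : Instance M} {t τ : ℝ} (h : x.IsNextArrival t τ) : τ ≤ x.tLast := by
  obtain ⟨⟨-, i, rfl⟩, -⟩ := h
  exact x.t_le_tLast i

theorem Instance.IsNextArrival.lt {M : Type u} {x : Instance M} {t τ : ℝ} (h : x.IsNextArrival t τ) : t < τ := h.1.1

/-! ### Termination -/

open Classical in
/-- The number of future arrivals, plus the number of undelivered requests, plus one if the predicted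
last arrival time lies in the future. -/
noncomputable def Instance.workLeft {M : Type u} (x : Instance M) (that : ℝ) (s : State x.n) : ℕ :=
  (Finset.univ.filter fun i => s.time < x.t i).card +
    (Finset.univ.filter fun i => i ∉ s.delivered).card + if s.time < that then 1 else 0

theorem Instance.workLeft_lt {M : Type u} {x : Instance M} {that : ℝ} {s s' : State x.n}
    (ht : s.time ≤ s'.time) (hD : s.delivered ⊆ s'.delivered)
    (h : (∃ i, s.time < x.t i ∧ x.t i ≤ s'.time) ∨ (∃ i, i ∉ s.delivered ∧ i ∈ s'.delivered) ∨
      (s.time < that ∧ that ≤ s'.time)) :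
    x.workLeft that s' < x.workLeft that s := by
  classical
  have hsub1 : (Finset.univ.filter fun i => s'.time < x.t i) ⊆
      Finset.univ.filter fun i => s.time < x.t i :=
    Finset.monotone_filter_right _ fun i _ h => ht.trans_lt h
  have hsub2 : (Finset.univ.filter fun i => i ∉ s'.delivered) ⊆
      Finset.univ.filter fun i => i ∉ s.delivered :=
    Finset.monotone_filter_right _ fun i _ h h' => h (hD h')
  have h1 := Finset.card_le_card hsub1
  have h2 := Finset.card_le_card hsub2
  have h3 : (if s'.time < that then 1 else 0) ≤ if s.time < that then 1 else 0 := by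
    split_ifs <;> first | omega | linarith
  unfold workLeft
  rcases h with ⟨i, hi, hi'⟩ | ⟨i, hi, hi'⟩ | ⟨h, h'⟩
  · have := Finset.card_lt_card (Finset.ssubset_iff_subset_ne.2 ⟨hsub1, fun h => by
      have := Finset.ext_iff.1 h i
      simp only [Finset.mem_filter, Finset.mem_univ, true_and] at this
      exact hi'.not_gt (this.2 hi)⟩)
    omega
  · have := Finset.card_lt_card (Finset.ssubset_iff_subset_ne.2 ⟨hsub2, fun h => by
      have := Finset.ext_iff.1 h i
      simp only [Finset.mem_filter, Finset.mem_univ, true_and] at this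
      exact this.2 hi hi'⟩)
    omega
  · rw [if_pos h, if_neg h'.not_gt]
    omega

section Executions

variable {M : Type u} [MetricSpace M] {x : Instance M} {that : ℝ} {s s' : State x.n}

theorem exists_step (hM : IsGeodesic M) (x : Instance M) (that : ℝ) (s : State x.n) :
    ∃ s', Step x that s s' := by
  by_cases hs : s.Finished
  · exact ⟨s, .halt s hs⟩
  rcases (x.unserved s).eq_empty_or_nonempty with hU | hU
  · obtain ⟨i, hi⟩ := not_forall.1 hs
    have hlt : s.time < x.t i := not_le.1 fun h => (hU ▸ ⟨h, hi⟩ : i ∈ (∅ : Set (Fin x.n)))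
    obtain ⟨τ, hτ, -⟩ := x.exists_isNextArrival hlt
    exact ⟨_, .wait s τ hU hτ⟩
  · obtain ⟨γ, hγ⟩ := hM.exists_shortestPaths
    obtain ⟨R, hR⟩ := x.exists_isOptimalRoute s
    obtain ⟨c, hc⟩ := x.exists_isCut hγ R that s.time
    by_cases h : ∃ i, s.time < x.t i ∧ x.t i < s.time + x.tripTime γ R c
    · obtain ⟨i, hi, hi'⟩ := h
      obtain ⟨τ, hτ, hle⟩ := x.exists_isNextArrival hi
      exact ⟨_, .interrupt s γ R c τ hγ hU hR hc hτ (hle.trans_lt hi')⟩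
    · exact ⟨_, .complete s γ R c hγ hU hR hc (not_exists.1 h)⟩

theorem exists_isExecution (hM : IsGeodesic M) (x : Instance M) (that : ℝ) :
    ∃ σ, IsExecution x that σ := by
  choose next hnext using exists_step hM x that
  exact ⟨fun k => next^[k] (State.init x.n), rfl, fun k => by
    simpa only [Function.iterate_succ_apply'] using hnext _⟩

/-- After an uncut trip, all requests that were released at its start are delivered. -/
theorem Instance.mem_delivered_update {R : List (Stop x.n)} (hR : x.IsRoute s R) {i : Fin x.n}
    (hi : x.t i ≤ s.time) (t : ℝ) :
    i ∈ (s.update t (x.reached x.o R (x.routeLength R))).delivered := by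
  rw [x.reached_of_pathLength_le x.o R [x.o] (s := x.routeLength R) le_rfl]
  by_cases h : i ∈ s.delivered
  · exact Or.inl h
  · exact Or.inr ((hR.2.2.1 i).2 ⟨hi, h⟩)

theorem Step.workLeft_lt (h : Step x that s s') (hs : ¬ s.Finished) :
    x.workLeft that s' < x.workLeft that s := by
  cases h with
  | halt h => exact absurd h hs
  | wait τ hU hτ =>
    obtain ⟨⟨hlt, i, rfl⟩, -⟩ := hτ
    exact Instance.workLeft_lt hlt.le subset_rfl (Or.inl ⟨i, hlt, le_rfl⟩)
  | complete γ R c hγ hU hR hc harr =>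
    refine Instance.workLeft_lt (le_add_of_nonneg_right hc.tripTime_nonneg)
      Set.subset_union_left ?_
    rcases hc.tripTime_eq hγ with ⟨h1, -, h2⟩ | ⟨-, rfl, -⟩
    · exact Or.inr (Or.inr ⟨h1, h2.ge⟩)
    · obtain ⟨i, hi⟩ := hU
      exact Or.inr (Or.inl ⟨i, hi.2, Instance.mem_delivered_update hR.1 hi.1 _⟩)
  | interrupt γ R c τ hγ hU hR hc hτ hlt =>
    obtain ⟨⟨hlt, i, rfl⟩, -⟩ := hτ
    have hle : x.t i ≤ x.t i + dist (x.tripPos γ R c (x.t i - s.time)) x.o :=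
      le_add_of_nonneg_right dist_nonneg
    exact Instance.workLeft_lt (hlt.le.trans hle) Set.subset_union_left (Or.inl ⟨i, hlt, hle⟩)

theorem IsExecution.exists_completesAt {σ : ℕ → State x.n} (h : IsExecution x that σ) :
    ∃ Z, CompletesAt σ Z := by
  classical
  have hfin : ∃ k, (σ k).Finished := by
    by_contra hne
    rw [not_exists] at hne
    obtain ⟨k, hk⟩ := WellFounded.not_rel_apply_succ (r := (· < ·)) fun k => x.workLeft that (σ k)
    exact hk ((h.2 k).workLeft_lt (hne k))
  exact ⟨_, Nat.find hfin, Nat.find_spec hfin, fun j hj => Nat.find_min hfin hj, rfl⟩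

/-! ### Upper bounds -/

/-- A bound on the time of a moment of decision, where `Z` is the cost of an offline schedule. It
is either the first one after the last arrival (or an earlier one), or a later one at which the
prediction is outdated, or the end. -/
def Instance.TimeBound (x : Instance M) (that Z : ℝ) (s : State x.n) : Prop :=
  (s.time ≤ x.tLast + Z / 2 ∧ s.time ≤ x.tLast + |that - x.tLast|) ∨
  (x.tLast ≤ s.time ∧ that ≤ s.time ∧ s.time ≤ x.tLast + 3 / 2 * Z ∧
    s.time ≤ x.tLast + |that - x.tLast|) ∨
  (x.tLast ≤ s.time ∧ s.Finished ∧ s.time ≤ x.tLast + 5 / 2 * Z ∧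
    s.time ≤ x.tLast + |that - x.tLast| + Z)

theorem Step.timeBound (h : Step x that s s') {Z : ℝ} (hZ : x.IsFeasible Z)
    (hs : x.TimeBound that Z s) : x.TimeBound that Z s' := by
  have hT := hZ.tLast_le
  have hT0 := x.tLast_nonneg
  have hε := le_abs_self (that - x.tLast)
  have hε' := neg_le_abs (that - x.tLast)
  have hε0 := abs_nonneg (that - x.tLast)
  cases h with
  | halt => exact hs
  | wait τ hU hτ =>
    have := hτ.le_tLast
    exact Or.inl ⟨by simp only; linarith, by simp only; linarith⟩
  | complete γ R c hγ hU hR hc harr =>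
    have hL := hZ.routeLength_le hR
    have htrip := hc.tripTime_le hγ
    have htrip0 := hc.tripTime_nonneg
    by_cases hlt : s.time < x.tLast
    · have := not_lt.1 fun h => harr _ ⟨hlt, h⟩
      have : s.time + x.tripTime γ R c ≤ x.tLast := this
      exact Or.inl ⟨by simp only [State.update]; linarith, by simp only [State.update]; linarith⟩
    rw [not_lt] at hlt
    rcases hc.tripTime_eq hγ with ⟨h1, h2, h3⟩ | ⟨h1, rfl, h3⟩
    · rcases hs with hs | hs | hs
      · refine Or.inr (Or.inl ?_)
        simp only [State.update]
        refine ⟨?_, ?_, ?_, ?_⟩ <;> linarith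
      · linarith
      · obtain ⟨i, hi⟩ := hU
        exact absurd (hs.2.1 i) hi.2
    · refine Or.inr (Or.inr ⟨?_, fun i =>
        Instance.mem_delivered_update hR.1 ((x.t_le_tLast i).trans hlt) _, ?_⟩)
      · simp only [State.update]
        linarith
      simp only [State.update]
      rcases hs with hs | hs | hs
      · constructor <;> linarith
      · constructor <;> linarith
      · obtain ⟨i, hi⟩ := hU
        exact absurd (hs.2.1 i) hi.2
  | interrupt γ R c τ hγ hU hR hc hτ hlt =>
    have hL := hZ.routeLength_le hR
    have htrip := hc.tripTime_le hγ
    have hτT := hτ.le_tLast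
    have hτs := hτ.lt
    obtain ⟨h1, h2⟩ := x.dist_tripPos_le hγ R hc.nonneg (s := τ - s.time) (by linarith)
      (by linarith)
    refine Or.inl ⟨?_, ?_⟩ <;> simp only [State.update]
    · linarith
    · rcases lt_or_ge s.time that with h | h
      · linarith [hc.add_tripTime_le hγ h]
      · linarith

theorem IsExecution.timeBound {σ : ℕ → State x.n} (h : IsExecution x that σ) {Z : ℝ}
    (hZ : x.IsFeasible Z) (k : ℕ) : x.TimeBound that Z (σ k) := by
  induction k with
  | zero =>
    have hT := hZ.tLast_le
    have hT0 := x.tLast_nonneg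
    have hε0 := abs_nonneg (that - x.tLast)
    rw [h.1]
    exact Or.inl ⟨by simp only [State.init]; linarith, by simp only [State.init]; linarith⟩
  | succ k ih => exact (h.2 k).timeBound hZ ih

theorem ladarLast_le_of_isFeasible {Z Z' : ℝ} (h : ladarLast M x that Z) (hZ : x.IsFeasible Z') :
    Z ≤ 7 / 2 * Z' ∧ Z ≤ 2 * Z' + |that - x.tLast| := by
  obtain ⟨σ, hσ, k, -, -, rfl⟩ := h
  have hT := hZ.tLast_le
  have hT0 := x.tLast_nonneg
  have hε0 := abs_nonneg (that - x.tLast)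
  rcases hσ.timeBound hZ k with h | h | h <;> constructor <;> linarith

theorem Instance.Zopt_nonneg (x : Instance M) : 0 ≤ x.Zopt :=
  Real.sInf_nonneg fun _ h => x.tLast_nonneg.trans (Instance.IsFeasible.tLast_le h)

theorem ladarLast_le_Zopt (hM : IsGeodesic M) {Z : ℝ} (h : ladarLast M x that Z) :
    Z ≤ 7 / 2 * x.Zopt ∧ Z ≤ 2 * x.Zopt + |that - x.tLast| := by
  have hne : {Z | x.IsFeasible Z}.Nonempty := x.exists_isFeasible hM
  constructor
  · have : Z / (7 / 2) ≤ x.Zopt := le_csInf hne fun Z' hZ' => by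
      linarith [(ladarLast_le_of_isFeasible h hZ').1]
    linarith
  · have : (Z - |that - x.tLast|) / 2 ≤ x.Zopt := le_csInf hne fun Z' hZ' => by
      linarith [(ladarLast_le_of_isFeasible h hZ').2]
    linarith

theorem ladarLast_le_min (hM : IsGeodesic M) {Z : ℝ} (h : ladarLast M x that Z) :
    Z ≤ min 3.5 (2 + |that - x.tLast| / x.Zopt) * x.Zopt := by
  obtain ⟨h1, h2⟩ := ladarLast_le_Zopt hM h
  rw [show (3.5 : ℝ) = 7 / 2 by norm_num]
  rcases x.Zopt_nonneg.eq_or_lt with h0 | h0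
  · rw [← h0, mul_zero] at h1 ⊢
    exact h1
  · rw [min_mul_of_nonneg _ _ h0.le, add_mul, div_mul_cancel₀ _ h0.ne']
    exact le_min h1 h2

end Executions

/-! ### An input on which the ratio is two -/

theorem isGeodesic_uliftReal : IsGeodesic (ULift.{u} ℝ) := by
  intro x y
  refine ⟨fun s => ⟨x.down + s * SignType.sign (y.down - x.down)⟩, ?_, ?_, ?_⟩
  · simp
  · apply ULift.down_injective
    rw [ULift.dist_eq, dist_comm, Real.dist_eq]
    simp [abs_mul_sign]
  · intro s hs t ht
    rw [ULift.dist_eq, Real.dist_eq]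
    rcases eq_or_ne x y with rfl | h
    · simp only [dist_self, Set.Icc_self, Set.mem_singleton_iff] at hs ht
      simp [hs, ht]
    · have h' : y.down - x.down ≠ 0 := sub_ne_zero.2 fun h' => h (ULift.down_injective h'.symm)
      rw [add_sub_add_left_eq_sub, ← sub_mul, abs_mul]
      rcases h'.lt_or_gt with h | h <;> simp [h]

/-- On the real line, the server is asked to visit the point `1` at time `1` and the origin at
time `2`. -/
def visitAndReturn : Instance (ULift.{u} ℝ) where
  n := 2
  n_pos := two_pos
  o := ⟨0⟩
  t := ![1, 2]
  t_nonneg := by simp [Fin.forall_fin_two]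
  t_mono := by simp [Fin.monotone_iff_le_succ]
  a := ![⟨1⟩, ⟨0⟩]
  b := ![⟨1⟩, ⟨0⟩]

theorem visitAndReturn_tLast : visitAndReturn.{u}.tLast = 2 := rfl

theorem visitAndReturn_isFeasible : visitAndReturn.{u}.IsFeasible 2 := by
  refine ⟨fun s => ⟨1 - |1 - s|⟩, ![1, 2], ![1, 2], ?_, fun s t _ _ => ?_, ?_, ?_⟩
  · simp [visitAndReturn]
  · rw [ULift.dist_eq, Real.dist_eq, sub_sub_sub_cancel_left]
    refine (abs_abs_sub_abs_le _ _).trans_eq ?_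
    rw [sub_sub_sub_cancel_left]
  · have h1 : (⟨1 - |1 - 1|⟩ : ULift.{u} ℝ) = ⟨1⟩ := by norm_num
    have h2 : (⟨1 - |1 - 2|⟩ : ULift.{u} ℝ) = ⟨0⟩ := by norm_num
    exact Fin.forall_fin_two.2
      ⟨⟨le_rfl, h1, le_rfl, h1, one_le_two⟩, ⟨le_rfl, h2, le_rfl, h2, le_rfl⟩⟩
  · norm_num [visitAndReturn]

/-- The moments of decision on this input, for a perfect prediction. -/
def visitAndReturnInv (s : State visitAndReturn.{u}.n) : Prop :=
  ((s.time = 0 ∨ s.time = 1 ∨ s.time = 2) ∧ (0 : Fin 2) ∉ s.delivered) ∨ 4 ≤ s.time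

theorem Step.visitAndReturnInv {s s' : State visitAndReturn.{u}.n}
    (h : Step visitAndReturn.{u} 2 s s') (hs : visitAndReturnInv s) : visitAndReturnInv s' := by
  have hunserved : ∀ i, i ∈ visitAndReturn.{u}.unserved s ↔
    visitAndReturn.{u}.t i ≤ s.time ∧ i ∉ s.delivered := fun _ => Iff.rfl
  have ht : ∀ i : Fin 2, visitAndReturn.{u}.t i = 1 ∨ visitAndReturn.{u}.t i = 2 :=
    Fin.forall_fin_two.2 ⟨Or.inl rfl, Or.inr rfl⟩
  have ht0 : visitAndReturn.{u}.t (0 : Fin 2) = 1 := rfl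
  have ht1 : visitAndReturn.{u}.t (1 : Fin 2) = 2 := rfl
  have hpos : dist visitAndReturn.{u}.o (visitAndReturn.{u}.pos (.deliver (0 : Fin 2))) = 1 := by
    simp [Instance.pos, visitAndReturn, ULift.dist_eq]
  rcases hs with ⟨hs, hD⟩ | hs
  swap
  · refine Or.inr (hs.trans ?_)
    cases h with
    | halt => exact le_rfl
    | wait τ hU hτ => exact hτ.lt.le
    | complete γ R c hγ hU hR hc harr => exact le_add_of_nonneg_right hc.tripTime_nonneg
    | interrupt γ R c τ hγ hU hR hc hτ hlt =>
      exact hτ.lt.le.trans (le_add_of_nonneg_right dist_nonneg)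
  have hlen : ∀ R, visitAndReturn.{u}.IsOptimalRoute s R → 1 ≤ s.time →
      2 ≤ visitAndReturn.{u}.routeLength R := by
    intro R hR h1
    have hmem := (hR.1.2.2.1 (0 : Fin 2)).2 ((hunserved _).2 ⟨h1, hD⟩)
    have := dist_add_dist_le_pathLength (p := visitAndReturn.{u}.o) (o := visitAndReturn.{u}.o)
      (List.mem_map_of_mem (f := visitAndReturn.{u}.pos) hmem)
    rw [dist_comm (visitAndReturn.{u}.pos _), hpos] at this
    exact le_trans (by norm_num) this
  have hone : (visitAndReturn.{u}.unserved s).Nonempty → 1 ≤ s.time := by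
    rintro ⟨i, hi⟩
    have := ((hunserved i).1 hi).1
    rcases ht i with h | h <;> linarith
  cases h with
  | halt h => exact absurd (h _) hD
  | wait τ hU hτ =>
    obtain ⟨⟨-, i, rfl⟩, -⟩ := hτ
    exact Or.inl ⟨Or.inr (ht i), hD⟩
  | complete γ R c hγ hU hR hc harr =>
    have h1 := hone hU
    have hL := hlen R hR h1
    rcases hc.tripTime_eq hγ with ⟨h2, h3, h4⟩ | ⟨h2, -, h4⟩
    · refine Or.inl ⟨Or.inr (Or.inr h4), ?_⟩
      have h5 : s.time = 1 := by
        rcases hs with h | h | h <;> linarith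
      rintro (h | h)
      · exact hD h
      · have h6 := visitAndReturn.{u}.dist_add_dist_le_of_mem_reached hγ _ _
          [visitAndReturn.{u}.o] h
        have h7 := dist_triangle (visitAndReturn.{u}.pos (.deliver (0 : Fin 2)))
          (posAlong γ visitAndReturn.{u}.o (visitAndReturn.{u}.points R) c) visitAndReturn.{u}.o
        rw [dist_comm _ visitAndReturn.{u}.o, hpos] at h7
        rw [hpos] at h6
        rw [Instance.tripTime] at h4
        rw [Instance.points] at h4 h7
        linarith
    · right
      have h5 : s.time = 2 := by
        rcases hs with h | h | h
        · linarith
        · exact absurd ⟨by linarith, by linarith⟩ h2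
        · exact h
      simp only [State.update]
      linarith
  | interrupt γ R c τ hγ hU hR hc hτ hlt =>
    have h1 := hone hU
    obtain ⟨⟨h2, i, rfl⟩, -⟩ := hτ
    have h3 : s.time < 2 := by
      rcases ht i with h | h <;> linarith
    have := hc.add_tripTime_le hγ h3
    rcases ht i with h | h <;> linarith

theorem four_le_of_ladarLast_visitAndReturn {Z : ℝ}
    (h : ladarLast _ visitAndReturn.{u} 2 Z) : 4 ≤ Z := by
  obtain ⟨σ, hσ, k, hk, -, rfl⟩ := h
  have hinv : ∀ k, visitAndReturnInv (σ k) := fun k => by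
    induction k with
    | zero =>
      rw [hσ.1]
      exact Or.inl ⟨Or.inl rfl, id⟩
    | succ k ih => exact (hσ.2 k).visitAndReturnInv ih
  rcases hinv k with h | h
  · exact absurd (hk _) h.2
  · exact h

theorem isConsistent_ladarLast : IsConsistent ladarLast.{u} 2 := by
  constructor
  · intro M _ hM x that Z hε h
    simpa [hε] using (ladarLast_le_Zopt hM h).2
  · intro c hc
    obtain ⟨σ, hσ⟩ := exists_isExecution isGeodesic_uliftReal visitAndReturn.{u} 2
    obtain ⟨Z, hZ⟩ := hσ.exists_completesAt
    have h1 := hc _ isGeodesic_uliftReal visitAndReturn.{u} 2 Z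
      (by rw [visitAndReturn_tLast, sub_self]) ⟨σ, hσ, hZ⟩
    have h2 := four_le_of_ladarLast_visitAndReturn ⟨σ, hσ, hZ⟩
    have h3 : visitAndReturn.{u}.Zopt ≤ 2 :=
      csInf_le ⟨0, fun _ h => (Instance.tLast_nonneg _).trans (Instance.IsFeasible.tLast_le h)⟩
        visitAndReturn_isFeasible
    have h4 := visitAndReturn.{u}.Zopt_nonneg
    by_contra! hlt
    have h5 : c * visitAndReturn.{u}.Zopt ≤ 2 * visitAndReturn.{u}.Zopt :=
      mul_le_mul_of_nonneg_right hlt.le h4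
    have h6 : visitAndReturn.{u}.Zopt = 2 := by linarith
    rw [h6] at h1
    linarith

end DialARide

theorem mainTheorem10 :
    (∀ (M : Type u) [MetricSpace M], DialARide.IsGeodesic M →
      ∀ (x : DialARide.Instance M) (that : ℝ),
        (∃ σ, DialARide.IsExecution x that σ) ∧
        (∀ σ, DialARide.IsExecution x that σ → ∃ Z, DialARide.CompletesAt σ Z) ∧
        (∀ Z, DialARide.ladarLast M x that Z →
          Z ≤ min 3.5 (2 + |that - x.tLast| / x.Zopt) * x.Zopt)) ∧
    DialARide.IsConsistent DialARide.ladarLast.{u} 2 ∧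
    DialARide.IsRobust DialARide.ladarLast.{u} 3.5 ∧
    DialARide.IsSmooth DialARide.ladarLast.{u} 2 (fun ε => |ε|) := by
  refine ⟨fun M _ hM x that => ⟨DialARide.exists_isExecution hM x that,
    fun σ hσ => hσ.exists_completesAt, fun Z h => DialARide.ladarLast_le_min hM h⟩,
    DialARide.isConsistent_ladarLast, fun ε M _ hM x that Z _ h => ?_,
    DialARide.isConsistent_ladarLast, continuous_abs, abs_zero,
    fun M _ hM x that Z h => (DialARide.ladarLast_le_Zopt hM h).2⟩
  rw [show (3.5 : ℝ) = 7 / 2 by norm_num]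
  exact (DialARide.ladarLast_le_Zopt hM h).1
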